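/- Let $L$ be a signature of finitary operation symbols and let $\mathbb V$ be a variety of $L$-algebras (the class of all $L$-algebras satisfying a given set of equations). Suppose that $\mathbb V$ is pointed, i.e. it has exactly one constant (there is a closed term, and any two closed terms are equal in all the algebras of $\mathbb V$), and that $\mathbb V$ is congruence modular, i.e. the lattice of congruences of every algebra in $\mathbb V$ is modular. Let $X$ be a non-empty algebra in $\mathbb V$. Call an $L$-homomorphism $p : X\times X\times X\to X$ a Mal'tsev operation on $X$ if $p(x,y,y)=x$ and $p(x,x,y)=y$ for all $x,y\in X$, and call $X$ affine in $\mathbb V$ if there is a Mal'tsev operation on $X$. Then $X$ is affine in $\mathbb V$ if and only if the diagonal $\{(x,x) : x\in X\}$ is a congruence class, i.e. there is a congruence on the algebra $X\times X$ one of whose equivalence classes is exactly the diagonal. Moreover, any Mal'tsev operation $p$ on $X$ is autonomous, i.e. $p(p(x,y,z),t,s)=p(x,y,p(z,t,s))$ and $p(x,y,z)=p(z,y,x)$ for all $x,y,z,t,s\in X$. -/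

import Mathlib

universe u v w

namespace UnivAlg

/-- Componentwise operations on the product of two algebras. -/
instance prodStructure (L : FirstOrder.Language.{u, v}) (A B : Type*) [L.Structure A] [L.Structure B] :
    L.Structure (A × B) where
  funMap f x :=
    (FirstOrder.Language.Structure.funMap f fun i => (x i).1, FirstOrder.Language.Structure.funMap f fun i => (x i).2)
  RelMap r x :=
    (FirstOrder.Language.Structure.RelMap r fun i => (x i).1) ∧ FirstOrder.Language.Structure.RelMap r fun i => (x i).2

/-- A congruence: an equivalence relation compatible with all the operations. -/
@[ext]
structure Congruence (L : FirstOrder.Language.{u, v}) (A : Type*) [L.Structure A] extends Setoid A where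
  compatible : ∀ {n : ℕ} (f : L.Functions n) (x y : Fin n → A), (∀ i, toSetoid (x i) (y i)) →
    toSetoid (FirstOrder.Language.Structure.funMap f x) (FirstOrder.Language.Structure.funMap f y)

namespace Congruence

variable {L : FirstOrder.Language.{u, v}} {A : Type*} [L.Structure A]

theorem toSetoid_injective :
    Function.Injective (toSetoid : Congruence L A → Setoid A) := by
  rintro ⟨r, _⟩ ⟨s, _⟩ h
  cases h
  rfl

/-- Congruences are ordered by inclusion. -/
instance : PartialOrder (Congruence L A) :=
  PartialOrder.lift toSetoid toSetoid_injective

/-- The infimum of a set of congruences is their intersection. -/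
instance : InfSet (Congruence L A) where
  sInf S :=
    { toSetoid := sInf (toSetoid '' S)
      compatible := by
        intro n f x y h
        simp only [Setoid.sInf_def] at h ⊢
        simp only [sInf_apply, iInf_apply, iInf_Prop_eq] at h ⊢
        rintro ⟨_, _, ⟨θ, hθ, rfl⟩, rfl⟩
        exact θ.compatible f x y fun i => h i ⟨_, _, ⟨θ, hθ, rfl⟩, rfl⟩ }

theorem isGLB_sInf (S : Set (Congruence L A)) : IsGLB S (sInf S) := by
  constructor
  · intro θ hθ
    exact sInf_le (α := Setoid A) ⟨θ, hθ, rfl⟩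
  · intro θ hθ
    refine le_sInf (α := Setoid A) ?_
    rintro _ ⟨φ, hφ, rfl⟩
    exact hθ hφ

/-- The complete lattice of congruences; joins are least upper bounds among congruences. -/
instance : CompleteLattice (Congruence L A) :=
  completeLatticeOfInf _ isGLB_sInf

end Congruence

/-- A variety of algebras of signature `L`, presented by a set of equations `s = t` between
terms in countably many variables. -/
structure Variety (L : FirstOrder.Language.{u, v}) where
  equations : Set (L.Term ℕ × L.Term ℕ)

namespace Variety

variable {L : FirstOrder.Language.{u, v}}

/-- `A` is an algebra in the variety `V`: it satisfies all the equations of `V`. -/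
def Contains (V : Variety L) (A : Type*) [L.Structure A] : Prop :=
  ∀ e ∈ V.equations, ∀ a : ℕ → A, e.1.realize a = e.2.realize a

/-- Every algebra in `V` has a modular lattice of congruences. -/
def IsCongruenceModular (V : Variety L) : Prop :=
  ∀ (A : Type (max u w)) [L.Structure A], V.Contains A → IsModularLattice (Congruence L A)

/-- `V` has exactly one constant: there is a closed term `c`, and every closed term is equal
to `c` in all the algebras in `V`. -/
def IsPointed (V : Variety L) : Prop :=
  ∃ c : L.Term Empty, ∀ d : L.Term Empty, ∀ (A : Type (max u w)) [L.Structure A],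
    V.Contains A → d.realize (Empty.elim : Empty → A) = c.realize Empty.elim

end Variety

/-- `p` is an internal Mal'tsev operation on `X`: a homomorphism `X × X × X → X` satisfying the
Mal'tsev identities. -/
def IsMaltsev {L : FirstOrder.Language.{u, v}} {X : Type*} [L.Structure X]
    (p : FirstOrder.Language.Hom L (X × X × X) X) : Prop :=
  (∀ x y, p (x, y, y) = x) ∧ ∀ x y, p (x, x, y) = y

/-- An autonomous ternary operation: associative and commutative. -/
def IsAutonomous {X : Type*} (p : X × X × X → X) : Prop :=
  (∀ x y z t s, p (p (x, y, z), t, s) = p (x, y, p (z, t, s))) ∧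
    ∀ x y z, p (x, y, z) = p (z, y, x)

/-- An affine algebra: one that admits an internal Mal'tsev operation. -/
def IsAffine (L : FirstOrder.Language.{u, v}) (X : Type*) [L.Structure X] : Prop :=
  ∃ p : FirstOrder.Language.Hom L (X × X × X) X, IsMaltsev p

end UnivAlg

/-!
Two kinds of algebras are abelian, i.e. satisfy the term condition. If the diagonal of `X × X` is a
class of a congruence, apply a term to pairs related by this congruence. If `p` is a Mal'tsev
homomorphism, then every entry of a `2 × 2` matrix with constant rows or constant columns is
obtained from the other three by `p`, and `p` commutes with the term.

Conversely, congruence modularity of the free algebra on four generators gives Day's chain of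
quaternary terms, and on an abelian algebra Gumm's composition of these terms is a Mal'tsev term
`s`. The term condition makes `s` commute with all operations, so `X` is affine. Moreover every
Mal'tsev homomorphism `p` commutes with `s`, which forces `p = s`; so `p` commutes with itself, and
an Eckmann-Hilton argument makes it autonomous. Associativity of `p` then makes `p(a, b, d) = c` a
congruence between `(a, b)` and `(c, d)`, and the diagonal is one of its classes.
-/

namespace UnivAlg

open FirstOrder.Language FirstOrder.Language.Structure Relation

variable {L : FirstOrder.Language.{u, v}}

theorem reflTransGen_map_of_forall_update {ι A B : Type*} [Finite ι] [DecidableEq ι]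
    {r : A → A → Prop} {q : B → B → Prop} {F : (ι → A) → B}
    (hF : ∀ z i a b, r a b → q (F (Function.update z i a)) (F (Function.update z i b)))
    {x y : ι → A} (hxy : ∀ i, ReflTransGen r (x i) (y i)) : ReflTransGen q (F x) (F y) := by
  cases nonempty_fintype ι
  suffices h : ∀ s : Finset ι, ReflTransGen q (F x) (F (s.piecewise y x)) by
    simpa only [Finset.piecewise_univ] using h Finset.univ
  intro s
  induction s using Finset.induction_on with
  | empty => simp only [Finset.piecewise_empty, ReflTransGen.refl]
  | insert i s hi ih =>
    have hx : Function.update (s.piecewise y x) i (x i) = s.piecewise y x := by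
      rw [← Finset.piecewise_eq_of_notMem s y x hi, Function.update_eq_self]
    have hstep := (hxy i).lift (p := q) (fun a => F (Function.update (s.piecewise y x) i a))
      fun a b => hF _ i a b
    rw [Function.onFun, hx, ← Finset.piecewise_insert] at hstep
    exact ih.trans hstep

namespace Congruence

variable {A : Type*} [L.Structure A] {θ φ : Congruence L A} {a b : A}

theorem le_def : θ ≤ φ ↔ ∀ {a b}, θ.toSetoid a b → φ.toSetoid a b :=
  Iff.rfl

theorem inf_apply : (θ ⊓ φ).toSetoid a b ↔ θ.toSetoid a b ∧ φ.toSetoid a b := by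
  let ψ : Congruence L A :=
    { toSetoid := θ.toSetoid ⊓ φ.toSetoid
      compatible := fun f x y hxy =>
        ⟨θ.compatible f x y fun i => (hxy i).1, φ.compatible f x y fun i => (hxy i).2⟩ }
  have hψ : ψ ≤ θ ⊓ φ := le_inf (le_def.2 fun h => h.1) (le_def.2 fun h => h.2)
  exact ⟨fun h => ⟨le_def.1 inf_le_left h, le_def.1 inf_le_right h⟩, fun h => le_def.1 hψ h⟩

theorem funMap_update {n : ℕ} (θ : Congruence L A) (f : L.Functions n) (z : Fin n → A) (i : Fin n)
    (h : θ.toSetoid a b) :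
    θ.toSetoid (funMap f (Function.update z i a)) (funMap f (Function.update z i b)) := by
  refine θ.compatible f _ _ fun j => ?_
  rcases eq_or_ne j i with rfl | hj
  · simpa only [Function.update_self] using h
  · simpa only [Function.update_of_ne hj] using Setoid.refl' _ (z j)

theorem reflTransGen_of_sup (h : (θ ⊔ φ).toSetoid a b) :
    ReflTransGen (fun x y => θ.toSetoid x y ∨ φ.toSetoid x y) a b := by
  let r : A → A → Prop := fun x y => θ.toSetoid x y ∨ φ.toSetoid x y
  have hsymm : Std.Symm r := ⟨fun _ _ => Or.imp (Setoid.symm' _) (Setoid.symm' _)⟩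
  let ψ : Congruence L A :=
    { r := ReflTransGen r
      iseqv := ⟨fun _ => .refl, ReflTransGen.stdSymm.symm _ _, .trans⟩
      compatible := fun f _ _ => reflTransGen_map_of_forall_update (r := r) (q := r)
        fun z i _ _ => Or.imp (θ.funMap_update f z i) (φ.funMap_update f z i) }
  have hψ : θ ⊔ φ ≤ ψ :=
    sup_le (le_def.2 fun h => .single (.inl h)) (le_def.2 fun h => .single (.inr h))
  exact le_def.1 hψ h

theorem realize {ι : Type*} (θ : Congruence L A) (t : L.Term ι) {v w : ι → A}
    (h : ∀ i, θ.toSetoid (v i) (w i)) : θ.toSetoid (t.realize v) (t.realize w) := by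
  induction t with
  | var i => exact h i
  | func f ts ih => exact θ.compatible f _ _ ih

end Congruence

section Realize

variable {A B X ι : Type*} [L.Structure A] [L.Structure B] [L.Structure X]

theorem realize_prodMk (t : L.Term ι) (v : ι → A) (w : ι → B) :
    t.realize (fun i => (v i, w i)) = (t.realize v, t.realize w) := by
  induction t with
  | var i => rfl
  | func f ts ih =>
    simp only [Term.realize, ih]
    rfl

theorem hom_realize_prodMk (p : FirstOrder.Language.Hom L (X × X × X) X) (t : L.Term ι)
    (x y z : ι → X) :
    p (t.realize x, t.realize y, t.realize z) = t.realize fun i => p (x i, y i, z i) := by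
  rw [← realize_prodMk, ← realize_prodMk]
  exact (HomClass.realize_term p).symm

theorem realize_subst_vec₃ (t : L.Term (Fin 3)) (t₀ t₁ t₂ : L.Term ι) (v : ι → X) :
    (t.subst ![t₀, t₁, t₂]).realize v = t.realize ![t₀.realize v, t₁.realize v, t₂.realize v] := by
  rw [Term.realize_subst]
  congr 1
  ext i
  fin_cases i <;> rfl

theorem realize_subst_vec₄ (t : L.Term (Fin 4)) (t₀ t₁ t₂ t₃ : L.Term ι) (v : ι → X) :
    (t.subst ![t₀, t₁, t₂, t₃]).realize v =
      t.realize ![t₀.realize v, t₁.realize v, t₂.realize v, t₃.realize v] := by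
  rw [Term.realize_subst]
  congr 1
  ext i
  fin_cases i <;> rfl

end Realize

/-- The algebra of `ι`-ary term functions on `X`, i.e. the free algebra on `ι` in the variety
generated by `X`. -/
def TermFunction (L : FirstOrder.Language.{u, v}) (ι X : Type*) [L.Structure X] :
    Set ((ι → X) → X) :=
  Set.range fun (t : L.Term ι) (v : ι → X) => t.realize v

namespace TermFunction

variable {ι X : Type*} [L.Structure X]

instance : CoeFun (TermFunction L ι X) fun _ => (ι → X) → X :=
  ⟨Subtype.val⟩

instance : L.Structure (TermFunction L ι X) where
  funMap f x := ⟨fun v => funMap f fun i => x i v, by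
    choose t ht using fun i => (x i).2
    exact ⟨Term.func f t, by simp only [Term.realize, ← ht]⟩⟩
  RelMap r x := ∀ v, RelMap r fun i => x i v

variable (L X) in
/-- The projection of `ι → X` to a coordinate, a free generator of the algebra of term
functions. -/
def proj (i : ι) : TermFunction L ι X :=
  ⟨fun v => v i, Term.var i, rfl⟩

theorem realize_apply {κ : Type*} (t : L.Term κ) (a : κ → TermFunction L ι X) (v : ι → X) :
    t.realize a v = t.realize fun k => a k v := by
  induction t with
  | var i => rfl
  | func f ts ih =>
    simp only [Term.realize, ← ih]
    rfl

theorem contains {V : Variety L} (hX : V.Contains X) : V.Contains (TermFunction L ι X) :=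
  fun e he a => Subtype.ext <| funext fun v => by
    rw [realize_apply, realize_apply, hX e he]

/-- The congruence of agreement on a set of tuples. -/
def agree (s : Set (ι → X)) : Congruence L (TermFunction L ι X) where
  toSetoid := Setoid.comap (fun f => s.domRestrict f) ⊥
  compatible f _ _ h := funext fun v => congrArg (funMap f) (funext fun i => congrFun (h i) v)

theorem agree_apply {s : Set (ι → X)} {f g : TermFunction L ι X} :
    (agree s).toSetoid f g ↔ Set.EqOn f g s :=
  Set.domRestrict_eq_domRestrict_iff

/-- The links of Day's chains of quaternary terms: both functions take the same value at all
`(a, b, b, a)`, and also at all `(a, a, c, c)` or at all `(a, b, b, c)`. -/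
def DayLink (f g : TermFunction L (Fin 4) X) : Prop :=
  (∀ a b, f ![a, b, b, a] = g ![a, b, b, a]) ∧
    ((∀ a c, f ![a, a, c, c] = g ![a, a, c, c]) ∨ ∀ a b c, f ![a, b, b, c] = g ![a, b, b, c])

/- Modularity is applied to the kernels `R`, `S`, `T` of the identifications `x = u ∧ y = z`,
`x = y ∧ z = u` and `y = z` of the free generators `x, y, z, u`. -/
theorem reflTransGen_dayLink [IsModularLattice (Congruence L (TermFunction L (Fin 4) X))] :
    ReflTransGen DayLink (proj L X (0 : Fin 4)) (proj L X 3) := by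
  let R : Congruence L (TermFunction L (Fin 4) X) := agree {v | ∃ a b, v = ![a, b, b, a]}
  let S : Congruence L (TermFunction L (Fin 4) X) := agree {v | ∃ a c, v = ![a, a, c, c]}
  let T : Congruence L (TermFunction L (Fin 4) X) := agree {v | ∃ a b c, v = ![a, b, b, c]}
  have hTR : T ≤ R := Congruence.le_def.2 fun h => agree_apply.2 <|
    (agree_apply.1 h).mono (by rintro _ ⟨a, b, rfl⟩; exact ⟨a, b, a, rfl⟩)
  have hR : R.toSetoid (proj L X 0) (proj L X 3) :=
    agree_apply.2 fun v ⟨a, b, hv⟩ => hv ▸ rfl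
  have hS₀₁ : S.toSetoid (proj L X 0) (proj L X 1) :=
    agree_apply.2 fun v ⟨a, c, hv⟩ => hv ▸ rfl
  have hT₁₂ : T.toSetoid (proj L X 1) (proj L X 2) :=
    agree_apply.2 fun v ⟨a, b, c, hv⟩ => hv ▸ rfl
  have hS₂₃ : S.toSetoid (proj L X 2) (proj L X 3) :=
    agree_apply.2 fun v ⟨a, c, hv⟩ => hv ▸ rfl
  have hsup : (T ⊔ S).toSetoid (proj L X 0) (proj L X 3) :=
    Setoid.trans' _ (Congruence.le_def.1 le_sup_right hS₀₁) <|
      Setoid.trans' _ (Congruence.le_def.1 le_sup_left hT₁₂) <|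
        Congruence.le_def.1 le_sup_right hS₂₃
  have hmod : (T ⊔ S ⊓ R).toSetoid (proj L X 0) (proj L X 3) :=
    Congruence.le_def.1 (sup_inf_le_assoc_of_le S hTR) (Congruence.inf_apply.2 ⟨hsup, hR⟩)
  refine ReflTransGen.mono (fun f g h => ?_) _ _ (Congruence.reflTransGen_of_sup hmod)
  rcases h with hT | hSR
  · have h := agree_apply.1 hT
    exact ⟨fun a b => h ⟨a, b, a, rfl⟩, .inr fun a b c => h ⟨a, b, c, rfl⟩⟩
  · obtain ⟨hS, hR⟩ := Congruence.inf_apply.1 hSR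
    exact ⟨fun a b => agree_apply.1 hR ⟨a, b, rfl⟩, .inl fun a c => agree_apply.1 hS ⟨a, c, rfl⟩⟩

end TermFunction

section Abelian

variable {X : Type*} [L.Structure X]

variable (L X) in
/-- An abelian algebra: one that satisfies the term condition
`t(a, c) = t(a, d) → t(b, c) = t(b, d)` for tuples `a, b, c, d`. The two blocks of variables are
not named: the first consists of those `i` for which the matrix `!![v i, v' i; w i, w' i]` has
constant rows, the second of those for which it has constant columns. As a term has finitely many
variables, it suffices to consider `ι` in the lowest universe. -/
def IsAbelian : Prop :=
  ∀ ⦃ι : Type⦄ (t : L.Term ι) (v v' w w' : ι → X),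
    (∀ i, (v i = v' i ∧ w i = w' i) ∨ (v i = w i ∧ v' i = w' i)) →
      t.realize v = t.realize v' → t.realize w = t.realize w'

theorem isAbelian_of_diagonal_mem_classes {θ : Congruence L (X × X)}
    (hθ : Set.diagonal X ∈ θ.toSetoid.classes) : IsAbelian L X := by
  obtain ⟨o, ho⟩ := hθ
  have hdiag : ∀ x y : X, x = y ↔ θ.toSetoid (x, y) o := fun x y => Set.ext_iff.1 ho (x, y)
  intro ι t v v' w w' hvw ht
  have hcols : ∀ i, θ.toSetoid (w i, w' i) (v i, v' i) := by
    intro i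
    rcases hvw i with ⟨hv, hw⟩ | ⟨hi, hi'⟩
    · exact Setoid.trans' _ ((hdiag _ _).1 hw) (Setoid.symm' _ ((hdiag _ _).1 hv))
    · rw [hi, hi']
  have key := θ.realize t hcols
  rw [realize_prodMk, realize_prodMk] at key
  exact (hdiag _ _).2 (Setoid.trans' _ key ((hdiag _ _).1 ht))

variable {p : FirstOrder.Language.Hom L (X × X × X) X}

theorem IsMaltsev.isAbelian (hp : IsMaltsev p) : IsAbelian L X := by
  intro ι t v v' w w' hvw ht
  have hw' : w' = fun i => p (w i, v i, v' i) := by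
    ext i
    rcases hvw i with ⟨hv, hw⟩ | ⟨hi, hi'⟩
    · rw [← hv, hp.1, hw]
    · rw [hi, hp.2, hi']
  rw [hw', ← hom_realize_prodMk, ← ht, hp.1]

end Abelian

section MaltsevTerm

variable {X : Type*} [L.Structure X]

variable (X) in
/-- A ternary term inducing an operation on `X` that satisfies the Mal'tsev identities; unlike in
`IsMaltsev`, this operation need not be a homomorphism. -/
def IsMaltsevTerm (s : L.Term (Fin 3)) : Prop :=
  (∀ x y : X, s.realize ![x, y, y] = x) ∧ ∀ x y : X, s.realize ![x, x, y] = y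

variable (L) in
/-- There is a term `s` with `s(a, a, c) = c` and `s(a, b, b) = h a b` on `X`. Gumm's construction
of a Mal'tsev term proceeds through such terms from `h a b = b` to `h a b = a`. -/
def HasDifferenceTerm (h : X → X → X) : Prop :=
  ∃ s : L.Term (Fin 3), (∀ a c : X, s.realize ![a, a, c] = c) ∧
    ∀ a b : X, s.realize ![a, b, b] = h a b

variable (L X) in
theorem hasDifferenceTerm_snd : HasDifferenceTerm L fun _ b : X => b :=
  ⟨Term.var 2, fun _ _ => rfl, fun _ _ => rfl⟩

/- In module notation, `t(x, y, z, u) = x - δ(x - u) + γ(z - y)`. The given term is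
`s = δ(a - b) + c`, and the substitution `t(s, b, a, s)` adds `γ(a - b)` to it. -/
theorem IsAbelian.hasDifferenceTerm_bbaa_of_bbba (hX : IsAbelian L X) {t : L.Term (Fin 4)}
    (ht : ∀ a b : X, t.realize ![a, b, b, a] = a)
    (h : HasDifferenceTerm L fun a b : X => t.realize ![b, b, b, a]) :
    HasDifferenceTerm L fun a b : X => t.realize ![b, b, a, a] := by
  obtain ⟨s, hs, hs'⟩ := h
  refine ⟨t.subst ![s, Term.var 1, Term.var 0, s], fun a c => ?_, fun a b => ?_⟩ <;>
    rw [realize_subst_vec₄]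
  · exact (ht _ _).trans (hs a c)
  · set d := s.realize ![a, b, b]
    change t.realize ![d, b, a, d] = t.realize ![b, b, a, a]
    refine hX t ![d, b, b, d] ![b, b, b, a] _ _ (fun i => ?_) ((ht d b).trans (hs' a b))
    fin_cases i <;> simp

theorem IsAbelian.hasDifferenceTerm_bbba_of_bbaa (hX : IsAbelian L X) {t : L.Term (Fin 4)}
    (ht : ∀ a b : X, t.realize ![a, b, b, a] = a)
    (h : HasDifferenceTerm L fun a b : X => t.realize ![b, b, a, a]) :
    HasDifferenceTerm L fun a b : X => t.realize ![b, b, b, a] := by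
  obtain ⟨s, hs, hs'⟩ := h
  refine ⟨t.subst ![s, Term.var 0, Term.var 1, s], fun a c => ?_, fun a b => ?_⟩ <;>
    rw [realize_subst_vec₄]
  · exact (ht _ _).trans (hs a c)
  · set d := s.realize ![a, b, b]
    calc t.realize ![d, a, b, d]
        = t.realize ![b, a, a, a] := by
          refine hX t ![d, b, b, d] ![b, b, a, a] _ _ (fun i => ?_) ((ht d b).trans (hs' a b))
          fin_cases i <;> simp
      _ = t.realize ![b, b, b, a] := by
          refine hX t ![a, a, a, a] ![a, b, b, a] _ _ (fun i => ?_) ((ht a a).trans (ht a b).symm)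
          fin_cases i <;> simp

theorem IsAbelian.exists_isMaltsevTerm (hX : IsAbelian L X)
    [IsModularLattice (Congruence L (TermFunction L (Fin 4) X))] :
    ∃ s : L.Term (Fin 3), IsMaltsevTerm X s := by
  suffices h : ∀ g : TermFunction L (Fin 4) X,
      ReflTransGen TermFunction.DayLink (TermFunction.proj L X 0) g →
        (∀ a b, g ![a, b, b, a] = a) ∧ HasDifferenceTerm L fun a b => g ![b, b, b, a] by
    obtain ⟨-, s, hs, hs'⟩ := h _ TermFunction.reflTransGen_dayLink
    exact ⟨s, hs', hs⟩
  intro g hg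
  induction hg with
  | refl => exact ⟨fun _ _ => rfl, hasDifferenceTerm_snd L X⟩
  | @tail f g _ hfg ih =>
    obtain ⟨hf, hfs⟩ := ih
    obtain ⟨hR, hST⟩ := hfg
    have hg : ∀ a b, g ![a, b, b, a] = a := fun a b => (hR a b).symm.trans (hf a b)
    refine ⟨hg, ?_⟩
    rcases hST with hS | hT
    · obtain ⟨_, tf, rfl⟩ := f
      obtain ⟨_, tg, rfl⟩ := g
      have hlink : ∀ a c : X, tf.realize ![a, a, c, c] = tg.realize ![a, a, c, c] := hS
      have hgs := hX.hasDifferenceTerm_bbaa_of_bbba hf hfs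
      simp only [hlink] at hgs
      exact hX.hasDifferenceTerm_bbba_of_bbaa hg hgs
    · simpa only [hT] using hfs

theorem IsAbelian.realize_maltsevTerm_comm (hX : IsAbelian L X) {s : L.Term (Fin 3)}
    (hs : IsMaltsevTerm X s) {κ : Type} (t : L.Term κ) (x y z : κ → X) :
    t.realize (fun k => s.realize ![x k, y k, z k]) =
      s.realize ![t.realize x, t.realize y, t.realize z] := by
  let r : L.Term (Fin 4 × κ) := s.subst
    ![t.subst fun k => s.subst ![Term.var (0, k), Term.var (1, k), Term.var (3, k)],
      t.subst fun k => s.subst ![Term.var (1, k), Term.var (1, k), Term.var (3, k)],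
      t.relabel fun k => (2, k)]
  let val (x y z w : κ → X) : Fin 4 × κ → X := fun i => ![x, y, z, w] i.1 i.2
  have hr (x w) : r.realize (val x y z w) =
      s.realize ![t.realize fun k => s.realize ![x k, y k, w k], t.realize w, t.realize z] := by
    rw [realize_subst_vec₃, Term.realize_subst, Term.realize_subst, Term.realize_relabel]
    simp only [realize_subst_vec₃, Term.realize_var, val, Matrix.cons_val, hs.2]
    rfl
  -- `r(y, y, z, w) = t(z)` does not depend on `w`, hence neither does `r(x, y, z, w)`.
  have key : r.realize (val x y z z) = r.realize (val x y z y) := by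
    refine hX r (val y y z z) (val y y z y) _ _ ?_ ?_
    · rintro ⟨i, k⟩
      fin_cases i <;> simp [val]
    · simp only [hr, hs.2]
  simpa only [hr, hs.1] using key

theorem IsAbelian.isAffine [L.IsAlgebraic] (hX : IsAbelian L X) {s : L.Term (Fin 3)}
    (hs : IsMaltsevTerm X s) : IsAffine L X :=
  ⟨{ toFun := fun a => s.realize ![a.1, a.2.1, a.2.2]
     map_fun' := fun f _ => (hX.realize_maltsevTerm_comm hs (Term.func f Term.var) _ _ _).symm
     map_rel' := fun r => isEmptyElim r }, hs⟩

end MaltsevTerm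

section Maltsev

variable {X : Type*}

theorem isAutonomous_of_medial {p : X × X × X → X} (hright : ∀ x y, p (x, y, y) = x)
    (hleft : ∀ x y, p (x, x, y) = y)
    (hmedial : ∀ x y z x' y' z' x'' y'' z'',
      p (p (x, y, z), p (x', y', z'), p (x'', y'', z'')) =
        p (p (x, x', x''), p (y, y', y''), p (z, z', z''))) :
    IsAutonomous p := by
  refine ⟨fun x y z t s => ?_, fun x y z => ?_⟩
  · simpa only [hright, hleft] using hmedial x y z t t t t t s
  · simpa only [hright, hleft] using hmedial y y x y y y z y y

variable [L.Structure X] {p : FirstOrder.Language.Hom L (X × X × X) X}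

theorem IsMaltsev.apply_eq_realize (hp : IsMaltsev p) {s : L.Term (Fin 3)}
    (hs : IsMaltsevTerm X s) (x y z : X) : p (x, y, z) = s.realize ![x, y, z] := by
  have h := hom_realize_prodMk p s ![x, y, y] ![y, y, y] ![y, y, z]
  rw [hs.1, hs.1, hs.2] at h
  rw [h]
  congr 1
  ext i
  fin_cases i
  exacts [hp.1 x y, hp.1 y y, hp.2 y z]

theorem IsMaltsev.isAutonomous (hp : IsMaltsev p) {s : L.Term (Fin 3)}
    (hs : IsMaltsevTerm X s) : IsAutonomous p := by
  refine isAutonomous_of_medial hp.1 hp.2 fun x y z x' y' z' x'' y'' z'' => ?_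
  have h := hom_realize_prodMk p s ![x, y, z] ![x', y', z'] ![x'', y'', z'']
  simp only [← hp.apply_eq_realize hs] at h
  rw [h, hp.apply_eq_realize hs]
  congr 1
  ext i
  fin_cases i <;> rfl

/-- The congruence on `X × X` for which `(a, b)` and `(c, d)` are equivalent when
`a, b, d, c` is a parallelogram, i.e. `a - b + d = c` in affine notation. -/
def IsMaltsev.parallelogram (hp : IsMaltsev p)
    (hassoc : ∀ x y z t s, p (p (x, y, z), t, s) = p (x, y, p (z, t, s))) :
    Congruence L (X × X) where
  r a b := p (a.1, a.2, b.2) = b.1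
  iseqv :=
    { refl := fun a => hp.1 a.1 a.2
      symm := fun {a b} h => by rw [← h, hassoc, hp.2, hp.1]
      trans := fun {a b c} hab hbc => by rw [← hbc, ← hab, hassoc, hp.2] }
  compatible f x y hxy :=
    (p.map_fun f fun i => ((x i).1, (x i).2, (y i).2)).trans (congrArg (funMap f) (funext hxy))

theorem IsMaltsev.diagonal_mem_classes_parallelogram [Nonempty X] (hp : IsMaltsev p)
    (hassoc : ∀ x y z t s, p (p (x, y, z), t, s) = p (x, y, p (z, t, s))) :
    Set.diagonal X ∈ (hp.parallelogram hassoc).toSetoid.classes := by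
  obtain ⟨o⟩ := ‹Nonempty X›
  refine ⟨(o, o), Set.ext fun ⟨x, y⟩ => ⟨fun hxy => ?_, fun h => ?_⟩⟩
  · obtain rfl : x = y := hxy
    exact hp.2 x o
  · have hyx : p (o, o, y) = x := Setoid.symm' (hp.parallelogram hassoc).toSetoid h
    exact hyx.symm.trans (hp.2 o y)

end Maltsev

end UnivAlg

theorem mainTheorem7_general (L : FirstOrder.Language.{u, v}) [L.IsAlgebraic]
    (V : UnivAlg.Variety L) (hmodular : UnivAlg.Variety.IsCongruenceModular.{u, v, w} V)
    (X : Type (max u w)) [L.Structure X] (hX : V.Contains X) [Nonempty X] :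
    (UnivAlg.IsAffine L X ↔
      ∃ θ : UnivAlg.Congruence L (X × X), Set.diagonal X ∈ θ.toSetoid.classes) ∧
    ∀ p : FirstOrder.Language.Hom L (X × X × X) X,
      UnivAlg.IsMaltsev p → UnivAlg.IsAutonomous p := by
  have := hmodular (UnivAlg.TermFunction L (Fin 4) X) (UnivAlg.TermFunction.contains hX)
  have hautonomous : ∀ p : FirstOrder.Language.Hom L (X × X × X) X,
      UnivAlg.IsMaltsev p → UnivAlg.IsAutonomous p := by
    intro p hp
    obtain ⟨s, hs⟩ := hp.isAbelian.exists_isMaltsevTerm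
    exact hp.isAutonomous hs
  refine ⟨⟨?_, ?_⟩, hautonomous⟩
  · rintro ⟨p, hp⟩
    exact ⟨_, hp.diagonal_mem_classes_parallelogram (hautonomous p hp).1⟩
  · rintro ⟨θ, hθ⟩
    have habelian := UnivAlg.isAbelian_of_diagonal_mem_classes hθ
    obtain ⟨s, hs⟩ := habelian.exists_isMaltsevTerm
    exact habelian.isAffine hs

theorem mainTheorem7 (L : FirstOrder.Language.{u, v}) [L.IsAlgebraic]
    (V : UnivAlg.Variety L)
    (hpointed : UnivAlg.Variety.IsPointed.{u, v, w} V)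
    (hmodular : UnivAlg.Variety.IsCongruenceModular.{u, v, w} V)
    (X : Type (max u w)) [L.Structure X] (hX : V.Contains X) [Nonempty X] :
    (UnivAlg.IsAffine L X ↔
      ∃ θ : UnivAlg.Congruence L (X × X), Set.diagonal X ∈ θ.toSetoid.classes) ∧
    ∀ p : FirstOrder.Language.Hom L (X × X × X) X,
      UnivAlg.IsMaltsev p → UnivAlg.IsAutonomous p :=
  mainTheorem7_general L V hmodular X hX
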